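/- **Setting.** Let $\mathsf{Diff}$ be the category of nonempty smooth manifolds (finite-dimensional, of some dimension $n$, without boundary, Hausdorff, second countable) and smooth maps, let $\mathsf{SurjSub}$ be its subcategory with the same objects and with the surjective submersions as morphisms, and let $\mathcal F\colon\mathsf{SurjSub}\to\mathsf{Diff}$ be the inclusion. Write $\mathsf C=\mathsf{SurjSub}$. *Relative limits.* An *$\mathcal F$-limit* of a diagram $D$ in $\mathsf C$ is a cone over $D$ in $\mathsf C$ whose image under $\mathcal F$ is a limit of $\mathcal F\circ D$; *$\mathcal F$-pullbacks* and *$\mathcal F$-products* are the spans, respectively the families of projections, in $\mathsf C$ whose images under $\mathcal F$ are pullbacks, respectively products. $\mathcal F$ is *cone-tight* if, for any two $\mathcal F$-limits of a diagram in $\mathsf C$, the canonical isomorphism between their images is $\mathcal F(\Psi)$ for an isomorphism of cones $\Psi$ in $\mathsf C$. $\mathcal F$ is *span-extendable* if, whenever $(P;p_L,p_R)$ is an $\mathcal F$-pullback of $C_L\xrightarrow{c_L}C_A\xleftarrow{c_R}C_R$ and $(Q;q_L,q_R)$ is an $\mathcal F$-pullback of $Q_L\xrightarrow{c_L f}C_A\xleftarrow{c_R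 g}Q_R$, the induced morphism $\Phi\colon\mathcal F(Q)\to\mathcal F(P)$ is $\mathcal F(\Psi)$ for a morphism $\Psi\colon Q\to P$ in $\mathsf C$ with $p_L\Psi=f q_L$ and $p_R\Psi=g q_R$. $\mathsf C$ *has nondegenerate $\mathcal F$-pullbacks* if every cospan has an $\mathcal F$-pullback, $\mathcal F$ preserves terminal objects, and the apex of an $\mathcal F$-pullback is not terminal as soon as one of its feet is not terminal. *Actor index categories.* An actor index category $J$ is a finite poset whose elements are actor indices, constraint indices, and the interaction indices $\{i,j\}$ for the pairs of distinct actor indices $i,j$. Each actor index $i$ has a set $C_i$ of constraint indices; a distinguished constraint index $\star$ belongs to every $C_i$, and every constraint index belongs to some $C_i$ (in particular there is at least one actor index). The order is generated by $c\le i$ for $c\in C_i$ and $i\le\{i,j\}$. An *inclusion* $\iota\colon J_1\to J_2$ is an injective monotone map that sends actor, constraint and interaction indices to indices of the same kind, and $\star$ to $\star$. *ACM-diagrams.* Diagrams of shape $J$ reverse the order: $c\le i$ is sent to a morphism $f_{i,c}\colon D(i)\to D(c)$. An *ACM-diagram* of shape $J$ is a diagram $D$ of shape $J$ in $\mathsf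 C$ such that $D(\star)$ is terminal, no other $D(x)$ is terminal, and for all distinct actor indices $i,j$ there are an $\mathcal F$-product $P$ of the objects $D(c)$, $c\in C_i\cap C_j$, and morphisms $D(i)\to P\leftarrow D(j)$ in $\mathsf C$ with components $f_{i,c}$ and $f_{j,c}$ ($c\in C_i\cap C_j$), such that the span $D(i)\leftarrow D(\{i,j\})\to D(j)$ is an $\mathcal F$-pullback of $D(i)\to P\leftarrow D(j)$. *ACM-systems.* For a cone over $D$ with apex $X$, let $D^X$ be the diagram obtained by adjoining to $J$ a greatest element, which is sent to $X$, the new morphisms being sent to the legs of the cone. An *ACM-system* of shape $J$ is a natural isomorphism class $[D^X]$, where $D$ is an ACM-diagram of shape $J$ and $X$ is the apex of an $\mathcal F$-limit of $D$; such $D$ is said to represent the system. *Rigid inclusions.* A *subsystem inclusion* $S_1\to S_2$ of ACM-systems of shapes $J_1,J_2$ is an inclusion $\iota\colon J_1\to J_2$ for which there are representing ACM-diagrams $D_1$ of $S_1$ and $D_2$ of $S_2$ with $D_1=D_2\circ\iota$. It is a *simple rigid inclusion* if one of the following (mutually exclusive) conditions holds: $\iota$ is an isomorphism; $J_2$ has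 the same actor indices as $J_1$ and exactly one additional constraint index for one of them (exactly one additional relation $c\le i$); $J_2$ has exactly one additional actor index, whose only constraint index is $\star$, and nothing else is added apart from the resulting interaction indices. A *rigid inclusion* is a subsystem inclusion that is a finite composite of simple rigid inclusions between ACM-systems. **Theorem.** 1. $\mathsf{SurjSub}$ and $\mathsf{Diff}$ have terminal objects, $\mathcal F$ is faithful, cone-tight and span-extendable, and $\mathsf{SurjSub}$ has nondegenerate $\mathcal F$-pullbacks. 2. If $D_1$ and $D_2$ are naturally isomorphic diagrams in $\mathsf{SurjSub}$ whose shape is an actor index category, with $\mathcal F$-limits of apices $X_1$ and $X_2$, then $D_1^{X_1}$ and $D_2^{X_2}$ are naturally isomorphic; so the ACM-system of $D$ depends only on the natural isomorphism class of $D$. 3. There is a category $\mathsf{Kin}(\mathcal F)$ whose objects are the ACM-systems in $\mathsf{SurjSub}$ and whose morphisms are the rigid inclusions; the underlying inclusion of index categories of a composite is the composite of the underlying inclusions, and that of an identity is the identity. -/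

import Mathlib

open CategoryTheory CategoryTheory.Limits Opposite
open scoped Manifold ContDiff

universe u w w'

namespace ACM

/-! ### Limits, pullbacks and products relative to a functor -/

section Relative

variable {C : Type*} [Category* C] {C' : Type*} [Category* C'] (F : C ⥤ C')

/-- A cone `c` over `D` in `C` is an `F`-limit of `D` if its image is a limit of `D ⋙ F`. -/
def IsFLimit {J : Type*} [Category* J] {D : J ⥤ C} (c : Cone D) : Prop :=
  Nonempty (IsLimit (F.mapCone c))

/-- The span `⟨p, q⟩` is an `F`-pullback of the cospan `⟩f, g⟨`. -/
def IsFPullback {P X Y Z : C} (p : P ⟶ X) (q : P ⟶ Y) (f : X ⟶ Z) (g : Y ⟶ Z) : Prop :=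
  IsPullback (F.map p) (F.map q) (F.map f) (F.map g)

/-- The object `P` with the projections `π` is an `F`-product of the family `A`, that is, an
`F`-limit of the discrete diagram `A`. -/
def IsFProduct {ι : Type*} {A : ι → C} {P : C} (π : ∀ k, P ⟶ A k) : Prop :=
  IsFLimit F (Fan.mk P π)

/-- `X` is a terminal object. -/
def IsTerminalObj {C : Type*} [Category* C] (X : C) : Prop := Nonempty (IsTerminal X)

/-- Every cospan in `C` has an `F`-pullback. -/
def HasFPullbacks : Prop :=
  ∀ ⦃X Y Z : C⦄ (f : X ⟶ Z) (g : Y ⟶ Z), ∃ (P : C) (p : P ⟶ X) (q : P ⟶ Y), IsFPullback F p q f g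

/-- `C` has nondegenerate `F`-pullbacks: it has `F`-pullbacks, `F` preserves terminal objects, and
the apex of an `F`-pullback is not terminal as soon as one of its feet is not terminal. -/
def HasNondegenerateFPullbacks : Prop :=
  HasFPullbacks F ∧
  (∀ X : C, IsTerminalObj X → IsTerminalObj (F.obj X)) ∧
  (∀ ⦃P X Y Z : C⦄ (p : P ⟶ X) (q : P ⟶ Y) (f : X ⟶ Z) (g : Y ⟶ Z), IsFPullback F p q f g →
    (¬ IsTerminalObj X ∨ ¬ IsTerminalObj Y) → ¬ IsTerminalObj P)

/-- `F` is cone-tight: for any two `F`-limits of a diagram in `C`, the unique isomorphism between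
their images as limit cones is the image of an isomorphism of cones in `C`. -/
def ConeTight : Prop :=
  ∀ (J : Type w) [Category.{w'} J] (D : J ⥤ C) (c c' : Cone D)
    (h : IsLimit (F.mapCone c)) (h' : IsLimit (F.mapCone c')),
    ∃ e : c ≅ c', F.map e.hom.hom = (h.conePointUniqueUpToIso h').hom

/-- `F` is span-extendable: the induced morphism `Φ` in `C'` from (the image of) an `F`-pullback of
`⟩f ≫ cL, g ≫ cR⟨` to (the image of) an `F`-pullback of `⟩cL, cR⟨` is the image of a morphism of
spans in `C`. -/
def SpanExtendable : Prop :=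
  ∀ ⦃P Q CL CR CA QL QR : C⦄ (cL : CL ⟶ CA) (cR : CR ⟶ CA) (pL : P ⟶ CL) (pR : P ⟶ CR)
    (f : QL ⟶ CL) (g : QR ⟶ CR) (qL : Q ⟶ QL) (qR : Q ⟶ QR),
    IsFPullback F pL pR cL cR → IsFPullback F qL qR (f ≫ cL) (g ≫ cR) →
    ∀ Φ : F.obj Q ⟶ F.obj P, Φ ≫ F.map pL = F.map (qL ≫ f) → Φ ≫ F.map pR = F.map (qR ≫ g) →
      ∃ Ψ : Q ⟶ P, F.map Ψ = Φ ∧ Ψ ≫ pL = qL ≫ f ∧ Ψ ≫ pR = qR ≫ g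

end Relative

/-! ### Actor index categories -/

/-- The data that determine an actor index category: finite sets of actor indices and of constraint
indices, the set `con i` of constraint indices for each actor index `i`, and the distinguished
constraint index `star`, which is a constraint index for every actor index. Every constraint index
is a constraint index for some actor index (so, because of `star`, there is an actor index). -/
structure ActorIndex where
  Actor : Type
  Constraint : Type
  finite_actor : Finite Actor
  finite_constraint : Finite Constraint
  con : Actor → Set Constraint
  star : Constraint
  star_mem : ∀ i, star ∈ con i
  exists_mem_con : ∀ c, ∃ i, c ∈ con i

/-- The objects of an actor index category: the constraint indices, the actor indices, and the
interaction indices, which are the unordered pairs of distinct actor indices. -/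
inductive ActorIndex.Obj (J : ActorIndex) : Type
  | constraint (c : J.Constraint)
  | actor (i : J.Actor)
  | interaction (e : {e : Sym2 J.Actor // ¬ e.IsDiag})

namespace ActorIndex

variable {J J₁ J₂ J₃ : ActorIndex}

/-- The order generated by `c ≤ i` for `c ∈ con i` and `i ≤ {i, j}` for `i ≠ j`. -/
def Obj.le : J.Obj → J.Obj → Prop
  | .constraint c, .constraint c' => c = c'
  | .constraint c, .actor i => c ∈ J.con i
  | .constraint c, .interaction e => ∃ i ∈ e.1, c ∈ J.con i
  | .actor i, .actor j => i = j
  | .actor i, .interaction e => i ∈ e.1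
  | .interaction e, .interaction e' => e = e'
  | .actor _, .constraint _ => False
  | .interaction _, .constraint _ => False
  | .interaction _, .actor _ => False

instance : PartialOrder J.Obj where
  le := Obj.le
  le_refl x := by cases x <;> simp [Obj.le]
  le_trans x y z hxy hyz := by
    cases x <;> cases y <;> cases z <;> simp only [Obj.le] at hxy hyz ⊢ <;> grind
  le_antisymm x y hxy hyx := by
    cases x <;> cases y <;> simp only [Obj.le] at hxy hyx ⊢ <;> grind

/-- The interaction index `{i, j}`. -/
def pair (i j : J.Actor) (h : i ≠ j) : J.Obj := .interaction ⟨s(i, j), by simpa using h⟩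

theorem constraint_le_actor {i : J.Actor} {c : J.Constraint} (h : c ∈ J.con i) :
    Obj.constraint c ≤ Obj.actor i := h

theorem actor_le_pair_left {i j : J.Actor} (h : i ≠ j) : Obj.actor i ≤ pair i j h :=
  Sym2.mem_mk_left i j

theorem actor_le_pair_right {i j : J.Actor} (h : i ≠ j) : Obj.actor j ≤ pair i j h :=
  Sym2.mem_mk_right i j

/-- An inclusion of actor index categories that respects the ACM structure. A functor between posets
is a monotone map, and it is automatically faithful; it need not be full. -/
@[ext]
structure Inclusion (J₁ J₂ : ActorIndex) where
  toHom : J₁.Obj →o J₂.Obj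
  injective : Function.Injective toHom
  map_actor : ∀ i, ∃ i', toHom (.actor i) = .actor i'
  map_constraint : ∀ c, ∃ c', toHom (.constraint c) = .constraint c'
  map_interaction : ∀ e, ∃ e', toHom (.interaction e) = .interaction e'
  map_star : toHom (.constraint J₁.star) = .constraint J₂.star

namespace Inclusion

/-- The identity inclusion. -/
def id (J : ActorIndex) : Inclusion J J where
  toHom := OrderHom.id
  injective := Function.injective_id
  map_actor i := ⟨i, rfl⟩
  map_constraint c := ⟨c, rfl⟩
  map_interaction e := ⟨e, rfl⟩
  map_star := rfl

/-- The composite of the inclusions `ι : J₁ → J₂` and `κ : J₂ → J₃`. -/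
def comp (κ : Inclusion J₂ J₃) (ι : Inclusion J₁ J₂) : Inclusion J₁ J₃ where
  toHom := κ.toHom.comp ι.toHom
  injective := κ.injective.comp ι.injective
  map_actor i := by
    obtain ⟨i', h⟩ := ι.map_actor i
    obtain ⟨i'', h'⟩ := κ.map_actor i'
    exact ⟨i'', by simp [h, h']⟩
  map_constraint c := by
    obtain ⟨c', h⟩ := ι.map_constraint c
    obtain ⟨c'', h'⟩ := κ.map_constraint c'
    exact ⟨c'', by simp [h, h']⟩
  map_interaction e := by
    obtain ⟨e', h⟩ := ι.map_interaction e
    obtain ⟨e'', h'⟩ := κ.map_interaction e'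
    exact ⟨e'', by simp [h, h']⟩
  map_star := by simp [ι.map_star, κ.map_star]

/-- An inclusion as a functor. -/
def functor (ι : Inclusion J₁ J₂) : J₁.Obj ⥤ J₂.Obj := ι.toHom.monotone.functor

/-- The functor is an isomorphism of categories. -/
def IsIso (ι : Inclusion J₁ J₂) : Prop :=
  Function.Surjective ι.toHom ∧ ∀ x y, ι.toHom x ≤ ι.toHom y → x ≤ y

/-- The relation `c ∈ con i` in `J₂` is the image of such a relation in `J₁`. -/
def FromSource (ι : Inclusion J₁ J₂) (i : J₂.Actor) (c : J₂.Constraint) : Prop :=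
  ∃ (i₁ : J₁.Actor) (c₁ : J₁.Constraint), c₁ ∈ J₁.con i₁ ∧
    ι.toHom (.actor i₁) = .actor i ∧ ι.toHom (.constraint c₁) = .constraint c

/-- `J₂` has the same actor indices as `J₁`, and exactly one additional constraint index for one of
them, that is, exactly one additional relation `c ≤ i`. -/
def AddsConstraint (ι : Inclusion J₁ J₂) : Prop :=
  (∀ i : J₂.Actor, ∃ i₁, ι.toHom (.actor i₁) = .actor i) ∧
  ∃! p : J₂.Actor × J₂.Constraint, p.2 ∈ J₂.con p.1 ∧ ¬ ι.FromSource p.1 p.2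

/-- `J₂` has exactly one additional actor index `a`, the only constraint index for `a` is `star`,
and the constraint indices for the other actor indices are those of `J₁`. -/
def AddsActor (ι : Inclusion J₁ J₂) : Prop :=
  ∃ a : J₂.Actor, (∀ i : J₂.Actor, (∃ i₁, ι.toHom (.actor i₁) = .actor i) ↔ i ≠ a) ∧
    J₂.con a = {J₂.star} ∧ ∀ i ≠ a, ∀ c ∈ J₂.con i, ι.FromSource i c

end Inclusion

end ActorIndex

/-! ### ACM-diagrams and ACM-systems -/

section Systems

variable {C : Type*} [Category* C] {C' : Type*} [Category* C'] (F : C ⥤ C')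

/-- The constraint morphism `f_{i,c} : A_i ⟶ D(c)`; diagrams reverse the order of the index poset. -/
def constraintMor {J : ActorIndex} (D : J.Objᵒᵖ ⥤ C) {i : J.Actor} {c : J.Constraint}
    (h : c ∈ J.con i) : D.obj (op (.actor i)) ⟶ D.obj (op (.constraint c)) :=
  D.map (homOfLE (ActorIndex.constraint_le_actor h)).op

/-- `D` is an ACM-diagram. In `interaction`, the object `P` with the projections `π` is the
`F`-product of the constraints shared by the actors `i` and `j`, and `fi`, `fj` are the `F`-product
morphisms of their constraint morphisms to the shared constraints. -/
structure IsACMDiagram {J : ActorIndex} (D : J.Objᵒᵖ ⥤ C) : Prop where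
  terminal_iff : ∀ x : J.Obj, IsTerminalObj (D.obj (op x)) ↔ x = .constraint J.star
  interaction : ∀ (i j : J.Actor) (hij : i ≠ j),
    ∃ (P : C) (π : ∀ c : ↥(J.con i ∩ J.con j), P ⟶ D.obj (op (.constraint c.1)))
      (fi : D.obj (op (.actor i)) ⟶ P) (fj : D.obj (op (.actor j)) ⟶ P),
      IsFProduct F π ∧
      (∀ c, fi ≫ π c = constraintMor D c.2.1) ∧
      (∀ c, fj ≫ π c = constraintMor D c.2.2) ∧
      IsFPullback F (D.map (homOfLE (ActorIndex.actor_le_pair_left hij)).op)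
        (D.map (homOfLE (ActorIndex.actor_le_pair_right hij)).op) fi fj

/-- The cone diagram of `D` given by the cone `c`: the shape is extended by a new object (the
greatest element of the index poset, which is initial in the opposite category), sent to the apex
of `c`, and the new morphisms are sent to the legs of `c`. -/
def coneDiagram {J : Type*} [Category* J] {D : J ⥤ C} (c : Cone D) : WithInitial J ⥤ C :=
  WithInitial.lift D c.π.app (fun _ _ f => c.w f)

/-- `D` and `c` represent the natural isomorphism class `K` of cone diagrams: `D` is an ACM-diagram,
`c` is an `F`-limit of `D`, and `K` is the class of the cone diagram. -/
def Represents {J : ActorIndex} (D : J.Objᵒᵖ ⥤ C) (c : Cone D)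
    (K : Quotient (isIsomorphicSetoid (WithInitial J.Objᵒᵖ ⥤ C))) : Prop :=
  IsACMDiagram F D ∧ IsFLimit F c ∧ K = Quotient.mk _ (coneDiagram c)

/-- An ACM-system: an actor index category together with the natural isomorphism class of the cone
diagram of an `F`-limit of an ACM-diagram of that shape. -/
structure ACMSystem where
  shape : ActorIndex
  cls : Quotient (isIsomorphicSetoid (WithInitial shape.Objᵒᵖ ⥤ C))
  exists_rep : ∃ (D : shape.Objᵒᵖ ⥤ C) (c : Cone D), Represents F D c cls

variable {F}

/-- The inclusion `ι` of shapes is a subsystem inclusion of `S` into `T`: there are representing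
ACM-diagrams `D₁` of `S` and `D₂` of `T` such that `D₁` is the ACM subdiagram of `D₂` given
by `ι`. -/
def IsSubsystemInclusion (S T : ACMSystem F) (ι : S.shape.Inclusion T.shape) : Prop :=
  ∃ (D₁ : S.shape.Objᵒᵖ ⥤ C) (c₁ : Cone D₁) (D₂ : T.shape.Objᵒᵖ ⥤ C) (c₂ : Cone D₂),
    Represents F D₁ c₁ S.cls ∧ Represents F D₂ c₂ T.cls ∧ D₁ = ι.functor.op ⋙ D₂

/-- A simple rigid inclusion. The three alternatives exclude each other. -/
def IsSimpleRigid (S T : ACMSystem F) (ι : S.shape.Inclusion T.shape) : Prop :=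
  IsSubsystemInclusion S T ι ∧ (ι.IsIso ∨ ι.AddsConstraint ∨ ι.AddsActor)

/-- `ι` is the composite of a finite (nonempty) sequence of simple rigid inclusions. -/
inductive IsFiniteComposite :
    (S T : ACMSystem F) → S.shape.Inclusion T.shape → Prop
  | simple {S T : ACMSystem F} {ι : S.shape.Inclusion T.shape} :
      IsSimpleRigid S T ι → IsFiniteComposite S T ι
  | step {S T U : ACMSystem F} {ι : S.shape.Inclusion T.shape} {κ : T.shape.Inclusion U.shape} :
      IsFiniteComposite S T ι → IsSimpleRigid T U κ → IsFiniteComposite S U (κ.comp ι)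

/-- A rigid inclusion: a subsystem inclusion that is a finite composite of simple rigid
inclusions. -/
structure RigidInclusion (S T : ACMSystem F) where
  incl : S.shape.Inclusion T.shape
  isSubsystem : IsSubsystemInclusion S T incl
  isComposite : IsFiniteComposite S T incl

end Systems

/-! ### Smooth manifolds and surjective submersions -/

/-- A nonempty smooth manifold: finite-dimensional, without boundary, Hausdorff and
second countable. -/
structure Diff where
  dim : ℕ
  carrier : Type u
  [top : TopologicalSpace carrier]
  [charted : ChartedSpace (EuclideanSpace ℝ (Fin dim)) carrier]
  [smooth : IsManifold (𝓡 dim) ∞ carrier]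
  [t2 : T2Space carrier]
  [secondCountable : SecondCountableTopology carrier]
  [nonempty : Nonempty carrier]

namespace Diff

attribute [instance] top charted smooth t2 secondCountable nonempty

/-- Morphisms are smooth maps. -/
noncomputable instance : Category.{u} Diff.{u} where
  Hom M N := C^∞⟮𝓡 M.dim, M.carrier; 𝓡 N.dim, N.carrier⟯
  id _ := ContMDiffMap.id
  comp f g := g.comp f

/-- The smooth map underlying a morphism. -/
noncomputable def toMap {M N : Diff.{u}} (f : M ⟶ N) : C^∞⟮𝓡 M.dim, M.carrier; 𝓡 N.dim, N.carrier⟯ := f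

end Diff

/-- The smooth maps that are surjective submersions: surjective, with surjective differential at
every point. -/
def surjSub : MorphismProperty Diff.{u} := fun M N f =>
  Function.Surjective (Diff.toMap f) ∧
    ∀ x : M.carrier, Function.Surjective (mfderiv (𝓡 M.dim) (𝓡 N.dim) (Diff.toMap f) x)

instance : surjSub.{u}.IsMultiplicative where
  id_mem M := by
    refine ⟨fun x => ⟨x, rfl⟩, fun x => ?_⟩
    have : mfderiv (𝓡 M.dim) (𝓡 M.dim) (Diff.toMap (𝟙 M)) x = ContinuousLinearMap.id ℝ _ :=
      mfderiv_id
    rw [this]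
    exact Function.surjective_id
  comp_mem {M N K} f g hf hg := by
    refine ⟨hg.1.comp hf.1, fun x => ?_⟩
    have hfd : MDifferentiableAt (𝓡 M.dim) (𝓡 N.dim) (Diff.toMap f) x :=
      (Diff.toMap f).contMDiff.mdifferentiable (by simp) x
    have hgd : MDifferentiableAt (𝓡 N.dim) (𝓡 K.dim) (Diff.toMap g) (Diff.toMap f x) :=
      (Diff.toMap g).contMDiff.mdifferentiable (by simp) _
    have : mfderiv (𝓡 M.dim) (𝓡 K.dim) (Diff.toMap (f ≫ g)) x =
        (mfderiv (𝓡 N.dim) (𝓡 K.dim) (Diff.toMap g) (Diff.toMap f x)).comp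
          (mfderiv (𝓡 M.dim) (𝓡 N.dim) (Diff.toMap f) x) :=
      mfderiv_comp x hgd hfd
    rw [this]
    exact (hg.2 _).comp (hf.2 x)

/-- The subcategory of `Diff` with the same objects and with the surjective submersions as
morphisms. -/
abbrev SurjSub : Type (u + 1) := WideSubcategory surjSub.{u}

/-- The inclusion functor of `SurjSub` into `Diff`. -/
noncomputable abbrev surjSubInclusion : SurjSub.{u} ⥤ Diff.{u} := wideSubcategoryInclusion surjSub.{u}

end ACM

namespace ACM

section General

variable {C : Type*} [Category* C] {C' : Type*} [Category* C'] {F : C ⥤ C'}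

/-! ### Invariance under natural isomorphism -/

/-! The categorical part is invariance under natural isomorphism. Cone-tightness supplies an
isomorphism of apices, hence of cone diagrams, which is statement 2. Conversely an isomorphism of
cone diagrams restricts to one of diagrams, so any two representatives of a system have isomorphic
diagrams. Since being an ACM-diagram and being an `F`-limit both pass along such isomorphisms, the
two representatives of a middle system can be matched and subsystem inclusions compose. The category
`kin` is obtained this way for every functor `F`.

The geometric part rests on one criterion: a surjective smooth map is a submersion exactly when a
smooth local section passes through every point of its source (`surjSub_of_sections`,
`surjSub.exists_section`). Sections come from the local normal form of a submersion, which also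
gives charts on the set-theoretic fibre product and makes it a pullback in `Diff`. Lifting local
sections through pullbacks shows that projections of pullbacks (`surjSub_fst`) and induced maps
between pullbacks (`surjSub_of_isPullback`) are again surjective submersions, which gives
`F`-pullbacks and span-extendability. Diffeomorphisms are surjective submersions, which gives
cone-tightness. A surjective submersion out of a point ends in a point, which gives nondegeneracy.
-/

theorem IsFLimit.postcompose {J : Type*} [Category* J] {D D' : J ⥤ C} {c : Cone D}
    (hc : IsFLimit F c) (α : D ≅ D') : IsFLimit F ((Cone.postcompose α.hom).obj c) := by
  obtain ⟨hc⟩ := hc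
  exact ⟨((IsLimit.postcomposeHomEquiv (Functor.isoWhiskerRight α F) _).symm hc).ofIsoLimit
    (Functor.mapConePostcompose F).symm⟩

/-- Cones with isomorphic diagrams and compatibly isomorphic apices have isomorphic cone
diagrams. -/
def coneDiagramIso {J : Type*} [Category* J] {D D' : J ⥤ C} {c : Cone D} {c' : Cone D'}
    (α : D ≅ D') (e : c.pt ≅ c'.pt)
    (h : ∀ j, c.π.app j ≫ α.hom.app j = e.hom ≫ c'.π.app j) :
    coneDiagram c ≅ coneDiagram c' :=
  NatIso.ofComponents
    (fun X => match X with
      | .of j => α.app j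
      | .star => e)
    (by
      rintro (_ | _) (_ | _) f
      · exact α.hom.naturality f
      · exact f.elim
      · exact h _
      · exact (Category.id_comp _).trans (Category.comp_id _).symm)

/-- The diagram of a cone is recovered from its cone diagram. -/
def diagramIsoOfConeDiagramIso {J : Type*} [Category* J] {D D' : J ⥤ C} {c : Cone D} {c' : Cone D'}
    (e : coneDiagram c ≅ coneDiagram c') : D ≅ D' :=
  (WithInitial.inclLift D c.π.app (fun _ _ f => c.w f)).symm ≪≫
    Functor.isoWhiskerLeft WithInitial.incl e ≪≫
      WithInitial.inclLift D' c'.π.app (fun _ _ f => c'.w f)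

/-- For a cone-tight functor, the cone diagram of an `F`-limit depends only on the natural
isomorphism class of the diagram. -/
theorem ConeTight.nonempty_coneDiagram_iso (hF : ConeTight.{w, w'} F) {J : Type w}
    [Category.{w'} J] {D D' : J ⥤ C} {c : Cone D} {c' : Cone D'} (α : D ≅ D')
    (hc : IsFLimit F c) (hc' : IsFLimit F c') : Nonempty (coneDiagram c ≅ coneDiagram c') := by
  obtain ⟨h⟩ := hc.postcompose α
  obtain ⟨h'⟩ := hc'
  obtain ⟨e, -⟩ := hF J D' _ _ h h'
  exact ⟨coneDiagramIso α ((Cone.forget _).mapIso e) fun j => (e.hom.w j).symm⟩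

theorem isTerminalObj_congr {X Y : C} (e : X ≅ Y) : IsTerminalObj X ↔ IsTerminalObj Y :=
  ⟨fun ⟨h⟩ => ⟨h.ofIso e⟩, fun ⟨h⟩ => ⟨h.ofIso e.symm⟩⟩

theorem IsFProduct.of_iso {ι : Type*} {A B : ι → C} {P : C} {π : ∀ k, P ⟶ A k}
    (hπ : IsFProduct F π) (e : ∀ k, A k ≅ B k) : IsFProduct F fun k => π k ≫ (e k).hom := by
  obtain ⟨h⟩ := IsFLimit.postcompose (F := F) hπ 
    (Discrete.natIso (F := Discrete.functor A) (G := Discrete.functor B) fun k => e k.as)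
  exact ⟨h.ofIsoLimit (Cone.ext (Iso.refl _) fun j => by
    cases j
    exact (Category.id_comp _).symm)⟩

/-- The product object `P` is kept. Only its projections and the morphisms into it are adjusted by
`α`, so the two pullback squares are compared by the identity at `P`. -/
theorem IsACMDiagram.of_iso {J : ActorIndex} {D D' : J.Objᵒᵖ ⥤ C} (hD : IsACMDiagram F D)
    (α : D ≅ D') : IsACMDiagram F D' where
  terminal_iff x := (isTerminalObj_congr (α.app (op x))).symm.trans (hD.terminal_iff x)
  interaction i j hij := by
    obtain ⟨P, π, fi, fj, hπ, hfi, hfj, hP⟩ := hD.interaction i j hij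
    refine ⟨P, fun c => π c ≫ α.hom.app _, α.inv.app _ ≫ fi, α.inv.app _ ≫ fj,
      hπ.of_iso fun c => α.app _, fun c => ?_, fun c => ?_, ?_⟩
    · rw [Category.assoc, ← Category.assoc fi, hfi]
      exact NatIso.naturality_1 α _
    · rw [Category.assoc, ← Category.assoc fj, hfj]
      exact NatIso.naturality_1 α _
    · refine IsPullback.of_iso hP (F.mapIso (α.app _)) (F.mapIso (α.app _)) (F.mapIso (α.app _))
        (Iso.refl _) ?_ ?_ ?_ ?_
      · exact (F.map_comp _ _).symm.trans <|
          (congrArg F.map (α.hom.naturality _)).trans (F.map_comp _ _)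
      · exact (F.map_comp _ _).symm.trans <|
          (congrArg F.map (α.hom.naturality _)).trans (F.map_comp _ _)
      · exact (Category.comp_id _).trans <|
          (congrArg F.map (α.hom_inv_id_app_assoc _ fi)).symm.trans (F.map_comp _ _)
      · exact (Category.comp_id _).trans <|
          (congrArg F.map (α.hom_inv_id_app_assoc _ fj)).symm.trans (F.map_comp _ _)

/-- The class `K` is unchanged because the apex stays the same and the legs are composed with `α`.
-/
theorem Represents.of_iso {J : ActorIndex} {D D' : J.Objᵒᵖ ⥤ C} {c : Cone D}
    {K : Quotient (isIsomorphicSetoid (WithInitial J.Objᵒᵖ ⥤ C))} (h : Represents F D c K)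
    (α : D ≅ D') : Represents F D' ((Cone.postcompose α.hom).obj c) K :=
  ⟨h.1.of_iso α, h.2.1.postcompose α, h.2.2.trans <| Quotient.sound
    ⟨coneDiagramIso α (Iso.refl _) fun _ => (Category.id_comp _).symm⟩⟩

theorem Represents.nonempty_iso {J : ActorIndex} {D D' : J.Objᵒᵖ ⥤ C} {c : Cone D} {c' : Cone D'}
    {K : Quotient (isIsomorphicSetoid (WithInitial J.Objᵒᵖ ⥤ C))} (h : Represents F D c K)
    (h' : Represents F D' c' K) : Nonempty (D ≅ D') := by
  obtain ⟨e⟩ := Quotient.exact (h.2.2.symm.trans h'.2.2)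
  exact ⟨diagramIsoOfConeDiagramIso e⟩

/-! ### The category of ACM-systems and rigid inclusions -/

theorem isSubsystemInclusion_id (S : ACMSystem F) :
    IsSubsystemInclusion S S (ActorIndex.Inclusion.id S.shape) := by
  obtain ⟨D, c, h⟩ := S.exists_rep
  exact ⟨D, c, D, c, h, h, rfl⟩

/-- The two hypotheses may use different diagrams for `T`. The isomorphism between them, restricted
along `ι`, moves the representative of `S` to one that is strictly a restriction of `D₃`. -/
theorem IsSubsystemInclusion.comp {S T U : ACMSystem F} {ι : S.shape.Inclusion T.shape}
    {κ : T.shape.Inclusion U.shape} (hι : IsSubsystemInclusion S T ι)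
    (hκ : IsSubsystemInclusion T U κ) : IsSubsystemInclusion S U (κ.comp ι) := by
  obtain ⟨_, c₁, D₂, c₂, h₁, h₂, rfl⟩ := hι
  obtain ⟨_, c₂', D₃, c₃, h₂', h₃, rfl⟩ := hκ
  obtain ⟨α⟩ := h₂.nonempty_iso h₂'
  exact ⟨_, _, D₃, c₃, h₁.of_iso (Functor.isoWhiskerLeft ι.functor.op α), h₃, rfl⟩

/-- Concatenation of sequences; no reassociation is needed, since composition of inclusions is
associative by definition. -/
theorem IsFiniteComposite.comp {S T U : ACMSystem F} {ι : S.shape.Inclusion T.shape}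
    {κ : T.shape.Inclusion U.shape} (hι : IsFiniteComposite S T ι)
    (hκ : IsFiniteComposite T U κ) : IsFiniteComposite S U (κ.comp ι) := by
  induction hκ with
  | simple h => exact hι.step h
  | step _ h ih => exact ih.step h

theorem RigidInclusion.ext {S T : ACMSystem F} {f g : RigidInclusion S T}
    (h : f.incl = g.incl) : f = g := by
  cases f
  cases g
  cases h
  rfl

/-- The category of ACM-systems and rigid inclusions. -/
@[reducible]
def kin (F : C ⥤ C') : Category.{0} (ACMSystem F) where
  Hom S T := RigidInclusion S T
  id S := ⟨.id S.shape, isSubsystemInclusion_id S,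
    .simple ⟨isSubsystemInclusion_id S, .inl ⟨Function.surjective_id, fun _ _ h => h⟩⟩⟩
  comp f g := ⟨g.incl.comp f.incl, f.isSubsystem.comp g.isSubsystem,
    f.isComposite.comp g.isComposite⟩
  id_comp _ := RigidInclusion.ext rfl
  comp_id _ := RigidInclusion.ext rfl
  assoc _ _ _ := RigidInclusion.ext rfl

end General

/-! ### Local normal form of submersions -/

section VectorSpace

variable {E F : Type*} [NormedAddCommGroup E] [NormedSpace ℝ E] [FiniteDimensional ℝ E]
  [NormedAddCommGroup F] [NormedSpace ℝ F] [FiniteDimensional ℝ F]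

/-- A surjective linear map is a coordinate projection of a linear isomorphism. -/
theorem exists_continuousLinearEquiv_prod {G : Type*} [NormedAddCommGroup G] [NormedSpace ℝ G]
    [FiniteDimensional ℝ G] (A : E →L[ℝ] F) (hA : Function.Surjective A)
    (hG : Module.finrank ℝ F + Module.finrank ℝ G = Module.finrank ℝ E) :
    ∃ (Q : E →L[ℝ] G) (L : E ≃L[ℝ] F × G), (L : E →L[ℝ] F × G) = A.prod Q := by
  -- A projection onto the kernel of `A` supplies the coordinates that `A` forgets.
  obtain ⟨π, hπ⟩ := Submodule.ClosedComplemented.of_finiteDimensional A.ker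
  have hrank := A.toLinearMap.finrank_range_add_finrank_ker
  rw [LinearMap.range_eq_top.2 hA, finrank_top] at hrank
  have hker : Module.finrank ℝ A.ker = Module.finrank ℝ G := by
    omega
  let β : A.ker ≃L[ℝ] G := ContinuousLinearEquiv.ofFinrankEq hker
  let Q : E →L[ℝ] G := (β : A.ker →L[ℝ] G).comp π
  have hinj : Function.Injective (A.prod Q).toLinearMap := by
    rw [injective_iff_map_eq_zero]
    intro x hx
    obtain ⟨h₁, h₂⟩ := Prod.ext_iff.1 hx
    have h₃ : π x = 0 := β.map_eq_zero_iff.1 h₂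
    have h₄ := hπ ⟨x, h₁⟩
    exact congrArg Subtype.val (h₄.symm.trans h₃)
  let L := (LinearEquiv.ofInjectiveOfFinrankEq (A.prod Q).toLinearMap hinj
    (by rw [Module.finrank_prod, hG])).toContinuousLinearEquiv
  exact ⟨Q, L, rfl⟩

/-- Inverse function theorem for `g` completed by a linear map `Q` that is complementary to the
derivative of `g` at `x₀`. -/
theorem exists_openPartialHomeomorph_fst_eq {k : ℕ} {g : E → F} {U : Set E} (hU : IsOpen U)
    (hg : ContDiffOn ℝ ∞ g U) {x₀ : E} (hx₀ : x₀ ∈ U)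
    (hsurj : Function.Surjective (fderiv ℝ g x₀))
    (hk : Module.finrank ℝ F + k = Module.finrank ℝ E) :
    ∃ e : OpenPartialHomeomorph E (F × EuclideanSpace ℝ (Fin k)),
      x₀ ∈ e.source ∧ e.source ⊆ U ∧ (∀ x, (e x).1 = g x) ∧
      ContDiffOn ℝ ∞ e e.source ∧ ContDiffOn ℝ ∞ e.symm e.target := by
  obtain ⟨Q, L, hL⟩ := exists_continuousLinearEquiv_prod
    (G := EuclideanSpace ℝ (Fin k)) (fderiv ℝ g x₀) hsurj (by simpa using hk)
  let H : E → F × EuclideanSpace ℝ (Fin k) := fun x => (g x, Q x)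
  have hH : ContDiffOn ℝ ∞ H U := hg.prodMk Q.contDiff.contDiffOn
  have hHat : ∀ x ∈ U, ContDiffAt ℝ ∞ H x := fun x hx => hH.contDiffAt (hU.mem_nhds hx)
  have hderiv : HasFDerivAt H (L : E →L[ℝ] F × EuclideanSpace ℝ (Fin k)) x₀ := by
    rw [hL]
    exact ((hg.contDiffAt (hU.mem_nhds hx₀)).differentiableAt (by simp)).hasFDerivAt.prodMk
      Q.hasFDerivAt
  let e₀ := (hHat x₀ hx₀).toOpenPartialHomeomorph H hderiv (by simp)
  -- The inverse is smooth at points where the derivative of `H` is invertible, which so far is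
  -- known only at `x₀`. Invertibility is an open condition, so the source is cut down to where it
  -- holds.
  let V : Set E := U ∩ fderiv ℝ H ⁻¹'
    Set.range ((↑) : (E ≃L[ℝ] F × EuclideanSpace ℝ (Fin k)) → E →L[ℝ] F × EuclideanSpace ℝ (Fin k))
  have hV : IsOpen V := (hH.continuousOn_fderiv_of_isOpen hU (by simp)).isOpen_inter_preimage hU
    ContinuousLinearEquiv.isOpen
  refine ⟨e₀.restrOpen V hV, ⟨(hHat x₀ hx₀).mem_toOpenPartialHomeomorph_source hderiv (by simp),
    hx₀, L, hderiv.fderiv.symm⟩, fun x hx => hx.2.1, fun x => rfl, hH.mono fun x hx => hx.2.1, ?_⟩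
  intro z hz
  have hz' := (e₀.restrOpen V hV).map_target hz
  obtain ⟨-, hzU, M, hM⟩ := hz'
  refine ((e₀.restrOpen V hV).contDiffAt_symm (f₀' := M) hz ?_ (hHat _ hzU)).contDiffWithinAt
  rw [hM]
  exact ((hHat _ hzU).differentiableAt (by simp)).hasFDerivAt

end VectorSpace

section Manifold

variable {m p : ℕ}
  {Y : Type*} [TopologicalSpace Y] [ChartedSpace (EuclideanSpace ℝ (Fin m)) Y]
  {Z : Type*} [TopologicalSpace Z] [ChartedSpace (EuclideanSpace ℝ (Fin p)) Z] {g : Y → Z}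

theorem dim_le_of_surjective_mfderiv {y : Y}
    (hsurj : Function.Surjective (mfderiv (𝓡 m) (𝓡 p) g y)) : p ≤ m := by
  have h := LinearMap.finrank_le_finrank_of_surjective
    (R := ℝ) (M := EuclideanSpace ℝ (Fin m)) (M' := EuclideanSpace ℝ (Fin p))
    (f := (mfderiv (𝓡 m) (𝓡 p) g y).toLinearMap) hsurj
  simpa using h

open Topology in
/-- A map with a smooth local section through a point is a submersion at that point. -/
theorem surjective_mfderiv_of_section {y₀ : Y} {s : Z → Y}
    (hg : MDifferentiableAt (𝓡 m) (𝓡 p) g y₀)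
    (hs : MDifferentiableAt (𝓡 p) (𝓡 m) s (g y₀)) (hs₀ : s (g y₀) = y₀)
    (hgs : ∀ᶠ z in 𝓝 (g y₀), g (s z) = z) :
    Function.Surjective (mfderiv (𝓡 m) (𝓡 p) g y₀) := by
  intro v
  have h₁ : HasMFDerivAt (𝓡 m) (𝓡 p) g (s (g y₀)) (mfderiv (𝓡 m) (𝓡 p) g y₀) := by
    rw [hs₀]
    exact hg.hasMFDerivAt
  -- Chain rule: the derivative of `s` is a right inverse of the derivative of `g`.
  have h₂ := h₁.comp _ hs.hasMFDerivAt
  have h₃ : HasMFDerivAt (𝓡 p) (𝓡 p) (g ∘ s) (g y₀)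
      (ContinuousLinearMap.id ℝ (TangentSpace (𝓡 p) (g y₀))) :=
    (hasMFDerivAt_id (g y₀)).congr_of_eventuallyEq hgs
  have h₄ := hasMFDerivAt_unique h₂ h₃
  exact ⟨_, DFunLike.congr_fun h₄ v⟩

variable [IsManifold (𝓡 m) ∞ Y] [IsManifold (𝓡 p) ∞ Z]

/-- A chart of the source of a submersion whose first components are those of a chart of the
target. -/
theorem exists_submersion_chart (hg : ContMDiff (𝓡 m) (𝓡 p) ∞ g) (y₀ : Y)
    (hsurj : Function.Surjective (mfderiv (𝓡 m) (𝓡 p) g y₀)) :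
    ∃ e : OpenPartialHomeomorph Y
        (EuclideanSpace ℝ (Fin p) × EuclideanSpace ℝ (Fin (m - p))),
      y₀ ∈ e.source ∧
      (∀ y ∈ e.source, g y ∈ (chartAt (EuclideanSpace ℝ (Fin p)) (g y₀)).source ∧
        (e y).1 = chartAt (EuclideanSpace ℝ (Fin p)) (g y₀) (g y)) ∧
      ContMDiffOn (𝓡 m) 𝓘(ℝ, EuclideanSpace ℝ (Fin p) × EuclideanSpace ℝ (Fin (m - p))) ∞
        e e.source ∧
      ContMDiffOn 𝓘(ℝ, EuclideanSpace ℝ (Fin p) × EuclideanSpace ℝ (Fin (m - p))) (𝓡 m) ∞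
        e.symm e.target := by
  let cY := chartAt (EuclideanSpace ℝ (Fin m)) y₀
  let cZ := chartAt (EuclideanSpace ℝ (Fin p)) (g y₀)
  let G : EuclideanSpace ℝ (Fin m) → EuclideanSpace ℝ (Fin p) := cZ ∘ g ∘ cY.symm
  let U : Set (EuclideanSpace ℝ (Fin m)) := cY.target ∩ cY.symm ⁻¹' (g ⁻¹' cZ.source)
  have hU : IsOpen U := cY.isOpen_inter_preimage_symm (cZ.open_source.preimage hg.continuous)
  have hcYs : ContMDiffOn (𝓡 m) (𝓡 m) ∞ cY.symm cY.target := contMDiffOn_chart_symm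
  have hcY : ContMDiffOn (𝓡 m) (𝓡 m) ∞ cY cY.source := contMDiffOn_chart
  have hcZ : ContMDiffOn (𝓡 p) (𝓡 p) ∞ cZ cZ.source := contMDiffOn_chart
  have hG : ContDiffOn ℝ ∞ G U := by
    rw [← contMDiffOn_iff_contDiffOn]
    exact hcZ.comp (hg.comp_contMDiffOn (hcYs.mono fun _ h => h.1)) fun _ h => h.2
  have hy₀ : y₀ ∈ cY.source := mem_chart_source _ y₀
  have hx₀ : cY y₀ ∈ U := ⟨cY.map_source hy₀, by
    change g (cY.symm (cY y₀)) ∈ cZ.source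
    rw [cY.left_inv hy₀]
    exact mem_chart_source _ _⟩
  -- `mfderiv` is by definition the derivative of the map written in the charts at `y₀` and `g y₀`,
  -- which is `G`.
  have hGsurj : Function.Surjective (fderiv ℝ G (cY y₀)) := by
    have h := hsurj
    rw [(hg.mdifferentiable (by simp) y₀).mfderiv] at h
    simp only [writtenInExtChartAt, extChartAt, mfld_simps, fderivWithin_univ] at h
    exact h
  have hpm := dim_le_of_surjective_mfderiv hsurj
  obtain ⟨e, he₀, heU, he₁, hes, het⟩ := exists_openPartialHomeomorph_fst_eq (k := m - p) hU hG hx₀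
    hGsurj (by simp; omega)
  refine ⟨cY.trans e, ?_, ?_, ?_, ?_⟩
  · rw [OpenPartialHomeomorph.trans_source]
    exact ⟨hy₀, he₀⟩
  · intro y hy
    rw [OpenPartialHomeomorph.trans_source] at hy
    have h := (heU hy.2).2
    have h' : (e (cY y)).1 = cZ (g (cY.symm (cY y))) := he₁ _
    rw [Set.mem_preimage, Set.mem_preimage, cY.left_inv hy.1] at h
    rw [cY.left_inv hy.1] at h'
    exact ⟨h, h'⟩
  · rw [OpenPartialHomeomorph.trans_source]
    exact hes.contMDiffOn.comp (hcY.mono fun _ h => h.1) fun _ h => h.2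
  · rw [OpenPartialHomeomorph.trans_target]
    exact hcYs.comp (het.contMDiffOn.mono fun _ h => h.1) fun _ h => h.2

open Topology in
/-- A submersion has a smooth local section through every point. -/
theorem exists_local_section (hg : ContMDiff (𝓡 m) (𝓡 p) ∞ g) (y₀ : Y)
    (hsurj : Function.Surjective (mfderiv (𝓡 m) (𝓡 p) g y₀)) :
    ∃ s : Z → Y, ContMDiffAt (𝓡 p) (𝓡 m) ∞ s (g y₀) ∧ s (g y₀) = y₀ ∧
      ∀ᶠ z in 𝓝 (g y₀), g (s z) = z := by
  obtain ⟨e, he₀, he, -, het⟩ := exists_submersion_chart hg y₀ hsurj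
  let cZ := chartAt (EuclideanSpace ℝ (Fin p)) (g y₀)
  -- The section freezes the fibre coordinates at those of `y₀`.
  let σ : Z → EuclideanSpace ℝ (Fin p) × EuclideanSpace ℝ (Fin (m - p)) :=
    fun z => (cZ z, (e y₀).2)
  have hσ₀ : σ (g y₀) = e y₀ := Prod.ext (he y₀ he₀).2.symm rfl
  have hσ : ContMDiffAt (𝓡 p) 𝓘(ℝ, EuclideanSpace ℝ (Fin p) × EuclideanSpace ℝ (Fin (m - p))) ∞ σ
      (g y₀) :=
    ContMDiffAt.prodMk_space (contMDiffOn_chart.contMDiffAt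
      (cZ.open_source.mem_nhds (mem_chart_source _ _))) contMDiffAt_const
  have hmem : σ (g y₀) ∈ e.target := hσ₀ ▸ e.map_source he₀
  refine ⟨e.symm ∘ σ, ?_, ?_, ?_⟩
  · exact (het.contMDiffAt (e.open_target.mem_nhds hmem)).comp _ hσ
  · change e.symm (σ (g y₀)) = y₀
    rw [hσ₀, e.left_inv he₀]
  · filter_upwards [hσ.continuousAt.preimage_mem_nhds (e.open_target.mem_nhds hmem),
      cZ.open_source.mem_nhds (mem_chart_source _ (g y₀))] with z hz hz'
    obtain ⟨h₁, h₂⟩ := he _ (e.map_target hz)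
    rw [e.right_inv hz] at h₂
    exact (cZ.injOn hz' h₁ h₂).symm

end Manifold

/-! ### Manifold structures from slice charts -/

section Slice

variable {E H M W : Type*} [NormedAddCommGroup E] [NormedSpace ℝ E] [TopologicalSpace H]
  (I : ModelWithCorners ℝ E H) [TopologicalSpace M] [ChartedSpace H M] [TopologicalSpace W]

/-- A chart at `w` of the space `W` that is smooth in both directions as seen through the map `ι`
to a manifold: the chart extends smoothly along `ι`, and its inverse composed with `ι` is smooth. -/
structure SliceChart (k : ℕ) (ι : W → M) (w : W) where
  chart : OpenPartialHomeomorph W (EuclideanSpace ℝ (Fin k))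
  mem_source : w ∈ chart.source
  ext : M → EuclideanSpace ℝ (Fin k)
  ext_eq : ∀ x ∈ chart.source, ext (ι x) = chart x
  smooth_ext : ∀ x ∈ chart.source, ContMDiffAt I (𝓡 k) ∞ ext (ι x)
  smooth_symm : ContMDiffOn (𝓡 k) I ∞ (ι ∘ chart.symm) chart.target

namespace SliceChart

variable {I} {k : ℕ} {ι : W → M} (s : ∀ w, SliceChart I k ι w)

/-- The charted space structure given by slice charts at all points. -/
@[reducible]
def chartedSpace : ChartedSpace (EuclideanSpace ℝ (Fin k)) W where
  atlas := Set.range fun w => (s w).chart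
  chartAt w := (s w).chart
  mem_chart_source w := (s w).mem_source
  chart_mem_atlas w := ⟨w, rfl⟩

theorem isManifold : letI := chartedSpace s; IsManifold (𝓡 k) ∞ W := by
  let := chartedSpace s
  refine isManifold_of_contDiffOn (𝓡 k) ∞ W ?_
  rintro _ _ ⟨w, rfl⟩ ⟨w', rfl⟩
  simp only [mfld_simps]
  rw [← contMDiffOn_iff_contDiffOn]
  intro z hz
  have h₁ : ContMDiffAt (𝓡 k) I ∞ (ι ∘ (s w).chart.symm) z :=
    (s w).smooth_symm.contMDiffAt ((s w).chart.open_target.mem_nhds hz.1)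
  -- The transition map factors through `M`: the inverse of one chart followed by `ι`, then the
  -- extension of the other chart.
  refine (((s w').smooth_ext _ hz.2).comp z h₁).contMDiffWithinAt.congr (fun y hy => ?_) ?_
  · exact ((s w').ext_eq _ hy.2).symm
  · exact ((s w').ext_eq _ hz.2).symm

theorem contMDiff : letI := chartedSpace s; ContMDiff (𝓡 k) I ∞ ι := by
  let := chartedSpace s
  have := isManifold s
  intro w
  have h₁ : ContMDiffAt (𝓡 k) (𝓡 k) ∞ (s w).chart w :=
    (contMDiffOn_chart (x := w)).contMDiffAt ((s w).chart.open_source.mem_nhds (s w).mem_source)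
  have h₂ : ContMDiffAt (𝓡 k) I ∞ (ι ∘ (s w).chart.symm) ((s w).chart w) :=
    (s w).smooth_symm.contMDiffAt
      ((s w).chart.open_target.mem_nhds ((s w).chart.map_source (s w).mem_source))
  refine (h₂.comp w h₁).congr_of_eventuallyEq ?_
  filter_upwards [(s w).chart.open_source.mem_nhds (s w).mem_source] with x hx
  simp [(s w).chart.left_inv hx]

/-- A map into `W` is smooth if its composite with `ι` is. -/
theorem contMDiffAt_of_comp (hι : Topology.IsInducing ι) {E' H' N : Type*} [NormedAddCommGroup E']
    [NormedSpace ℝ E'] [TopologicalSpace H'] {I' : ModelWithCorners ℝ E' H'} [TopologicalSpace N]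
    [ChartedSpace H' N] {h : N → W} {x : N} (hh : ContMDiffAt I' I ∞ (ι ∘ h) x) :
    letI := chartedSpace s; ContMDiffAt I' (𝓡 k) ∞ h x := by
  let := chartedSpace s
  have := isManifold s
  have hc : ContinuousAt h x := hι.continuousAt_iff.2 hh.continuousAt
  let c := (s (h x)).chart
  have hx : h x ∈ c.source := (s (h x)).mem_source
  have h₁ : ContMDiffAt I' (𝓡 k) ∞ (c ∘ h) x := by
    refine (((s (h x)).smooth_ext _ hx).comp x hh).congr_of_eventuallyEq ?_
    filter_upwards [hc.preimage_mem_nhds (c.open_source.mem_nhds hx)] with y hy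
    exact ((s (h x)).ext_eq _ hy).symm
  have h₂ : ContMDiffAt (𝓡 k) (𝓡 k) ∞ c.symm (c (h x)) :=
    (contMDiffOn_chart_symm (x := h x)).contMDiffAt (c.open_target.mem_nhds (c.map_source hx))
  refine (h₂.comp x h₁).congr_of_eventuallyEq ?_
  filter_upwards [hc.preimage_mem_nhds (c.open_source.mem_nhds hx)] with y hy
  exact (c.left_inv hy).symm

end SliceChart

end Slice

/-! ### Fibre products along submersions -/

section FibreProduct

variable {n m p : ℕ}
  {X : Type*} [TopologicalSpace X] [ChartedSpace (EuclideanSpace ℝ (Fin n)) X]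
  [IsManifold (𝓡 n) ∞ X]
  {Y : Type*} [TopologicalSpace Y] [ChartedSpace (EuclideanSpace ℝ (Fin m)) Y]
  [IsManifold (𝓡 m) ∞ Y]
  {Z : Type*} [TopologicalSpace Z] [ChartedSpace (EuclideanSpace ℝ (Fin p)) Z]
  [IsManifold (𝓡 p) ∞ Z] {f : X → Z} {g : Y → Z}

/-- A slice chart of the fibre product of a smooth map and a submersion, as a subspace of the
product. -/
theorem nonempty_sliceChart (hf : ContMDiff (𝓡 n) (𝓡 p) ∞ f) (hg : ContMDiff (𝓡 m) (𝓡 p) ∞ g)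
    (hsurj : ∀ y, Function.Surjective (mfderiv (𝓡 m) (𝓡 p) g y)) (w : {q : X × Y // f q.1 = g q.2}) :
    Nonempty (SliceChart ((𝓡 n).prod (𝓡 m)) (n + (m - p))
      (Subtype.val : {q : X × Y // f q.1 = g q.2} → X × Y) w) := by
  obtain ⟨⟨x₀, y₀⟩, hw⟩ := w
  change f x₀ = g y₀ at hw
  obtain ⟨e, he₀, he, hes, het⟩ := exists_submersion_chart hg y₀ (hsurj y₀)
  let cX := chartAt (EuclideanSpace ℝ (Fin n)) x₀
  let cZ := chartAt (EuclideanSpace ℝ (Fin p)) (g y₀)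
  have hcX : ContMDiffOn (𝓡 n) (𝓡 n) ∞ cX cX.source := contMDiffOn_chart
  have hcXs : ContMDiffOn (𝓡 n) (𝓡 n) ∞ cX.symm cX.target := contMDiffOn_chart_symm
  have hcZ : ContMDiffOn (𝓡 p) (𝓡 p) ∞ cZ cZ.source := contMDiffOn_chart
  let β : (EuclideanSpace ℝ (Fin n) × EuclideanSpace ℝ (Fin (m - p))) ≃L[ℝ]
      EuclideanSpace ℝ (Fin (n + (m - p))) := ContinuousLinearEquiv.ofFinrankEq (by simp)
  -- A point `(x, y)` of the fibre product has as coordinates those of `x` and the fibre coordinates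
  -- of `y`. The remaining coordinates of `y` are forced to be `cZ (f x)`, so `T` collects the
  -- values for which this prescription makes sense.
  let T : Set (EuclideanSpace ℝ (Fin n) × EuclideanSpace ℝ (Fin (m - p))) :=
    {a | a.1 ∈ cX.target ∧ f (cX.symm a.1) ∈ cZ.source ∧ (cZ (f (cX.symm a.1)), a.2) ∈ e.target}
  let T' : Set (EuclideanSpace ℝ (Fin n)) := cX.target ∩ cX.symm ⁻¹' (f ⁻¹' cZ.source)
  have hT' : IsOpen T' := cX.isOpen_inter_preimage_symm (cZ.open_source.preimage hf.continuous)
  have hfT : ContMDiffOn (𝓡 n) (𝓡 p) ∞ (fun a => cZ (f (cX.symm a))) T' :=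
    hcZ.comp (hf.comp_contMDiffOn (hcXs.mono fun _ h => h.1)) fun _ h => h.2
  let τ : EuclideanSpace ℝ (Fin n) × EuclideanSpace ℝ (Fin (m - p)) →
    EuclideanSpace ℝ (Fin p) × EuclideanSpace ℝ (Fin (m - p)) :=
    fun a => (cZ (f (cX.symm a.1)), a.2)
  have hτ : ContDiffOn ℝ ∞ τ (T' ×ˢ Set.univ) :=
    (hfT.contDiffOn.comp contDiff_fst.contDiffOn fun a ha => ha.1).prodMk contDiff_snd.contDiffOn
  have hT : T = (T' ×ˢ Set.univ) ∩ τ ⁻¹' e.target := by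
    ext a
    simp only [T, T', τ, Set.mem_ofPred_eq, Set.mem_inter_iff, Set.mem_prod, Set.mem_preimage,
      Set.mem_univ, and_true, and_assoc]
  have hTopen : IsOpen T := by
    rw [hT]
    exact hτ.continuousOn.isOpen_inter_preimage (hT'.prod isOpen_univ) e.open_target
  have hτT : ContDiffOn ℝ ∞ τ T := hτ.mono (hT ▸ Set.inter_subset_left)
  have hσX : ContMDiffOn 𝓘(ℝ, EuclideanSpace ℝ (Fin n) × EuclideanSpace ℝ (Fin (m - p))) (𝓡 n) ∞
      (fun a => cX.symm a.1) T :=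
    hcXs.comp contDiff_fst.contMDiff.contMDiffOn fun a ha => ha.1
  have hσY : ContMDiffOn 𝓘(ℝ, EuclideanSpace ℝ (Fin n) × EuclideanSpace ℝ (Fin (m - p))) (𝓡 m) ∞
      (fun a => e.symm (τ a)) T :=
    het.comp hτT.contMDiffOn fun a ha => ha.2.2
  have hfib : ∀ a ∈ T, f (cX.symm a.1) = g (e.symm (τ a)) := by
    intro a ha
    obtain ⟨h₁, h₂⟩ := he _ (e.map_target ha.2.2)
    rw [e.right_inv ha.2.2] at h₂
    exact cZ.injOn ha.2.1 h₁ h₂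
  let S : Set (X × Y) := {q | q.1 ∈ cX.source ∧ q.2 ∈ e.source}
  have hS : IsOpen S := cX.open_source.prod e.open_source
  let Φ : X × Y → EuclideanSpace ℝ (Fin n) × EuclideanSpace ℝ (Fin (m - p)) :=
    fun q => (cX q.1, (e q.2).2)
  have hΦ : ContMDiffOn ((𝓡 n).prod (𝓡 m))
      𝓘(ℝ, EuclideanSpace ℝ (Fin n) × EuclideanSpace ℝ (Fin (m - p))) ∞ Φ S :=
    ContMDiffOn.prodMk_space (hcX.comp contMDiffOn_fst fun _ h => h.1)
      (contDiff_snd.contMDiff.comp_contMDiffOn (hes.comp contMDiffOn_snd fun _ h => h.2))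
  have hτΦ : ∀ q : X × Y, f q.1 = g q.2 → q ∈ S → τ (Φ q) = e q.2 := by
    intro q hq hqS
    refine Prod.ext ?_ rfl
    change cZ (f (cX.symm (cX q.1))) = _
    rw [cX.left_inv hqS.1, hq, (he _ hqS.2).2]
  have hΦT : ∀ q : X × Y, f q.1 = g q.2 → q ∈ S → Φ q ∈ T := by
    intro q hq hqS
    refine ⟨cX.map_source hqS.1, ?_, ?_⟩
    · change f (cX.symm (cX q.1)) ∈ _
      rw [cX.left_inv hqS.1, hq]
      exact (he _ hqS.2).1
    · change τ (Φ q) ∈ _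
      rw [hτΦ _ hq hqS]
      exact e.map_source hqS.2
  classical
  let w₀ : {q : X × Y // f q.1 = g q.2} := ⟨(x₀, y₀), hw⟩
  let σ : EuclideanSpace ℝ (Fin n) × EuclideanSpace ℝ (Fin (m - p)) →
      {q : X × Y // f q.1 = g q.2} := fun a =>
    -- The value `w₀` outside `T` is arbitrary.
    if ha : a ∈ T then ⟨(cX.symm a.1, e.symm (τ a)), hfib a ha⟩ else w₀
  have hσ : ∀ a ∈ T, (σ a).1 = (cX.symm a.1, e.symm (τ a)) := fun a ha => by simp [σ, ha]
  let c : OpenPartialHomeomorph {q : X × Y // f q.1 = g q.2}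
      (EuclideanSpace ℝ (Fin n) × EuclideanSpace ℝ (Fin (m - p))) :=
    { toFun := fun q => Φ q.1
      invFun := σ
      source := Subtype.val ⁻¹' S
      target := T
      map_source' := fun q hq => hΦT _ q.2 hq
      map_target' := fun a ha => by
        change (σ a).1 ∈ S
        rw [hσ a ha]
        exact ⟨cX.map_target ha.1, e.map_target ha.2.2⟩
      left_inv' := fun q hq => by
        refine Subtype.ext ?_
        rw [hσ _ (hΦT _ q.2 hq), hτΦ _ q.2 hq, e.left_inv hq.2]
        exact Prod.ext (cX.left_inv hq.1) rfl
      right_inv' := fun a ha => by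
        rw [hσ a ha]
        refine Prod.ext (cX.right_inv ha.1) ?_
        change (e (e.symm (τ a))).2 = a.2
        rw [e.right_inv ha.2.2]
      open_source := hS.preimage continuous_subtype_val
      open_target := hTopen
      continuousOn_toFun := hΦ.continuousOn.comp continuous_subtype_val.continuousOn fun _ h => h
      continuousOn_invFun := by
        exact Topology.IsInducing.subtypeVal.continuousOn_iff.2
          ((hσX.continuousOn.prodMk hσY.continuousOn).congr hσ) }
  refine ⟨{
    chart := c.trans β.toHomeomorph.toOpenPartialHomeomorph
    mem_source := ?_
    ext := β ∘ Φ
    ext_eq := fun _ _ => rfl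
    smooth_ext := ?_
    smooth_symm := ?_ }⟩
  · rw [OpenPartialHomeomorph.trans_source]
    exact ⟨⟨mem_chart_source _ _, he₀⟩, trivial⟩
  · intro q hq
    rw [OpenPartialHomeomorph.trans_source] at hq
    exact β.contDiff.contMDiff.contMDiffAt.comp _ (hΦ.contMDiffAt (hS.mem_nhds hq.1))
  · rw [OpenPartialHomeomorph.trans_target]
    have h := (hσX.prodMk hσY).congr hσ
    exact h.comp β.symm.contDiff.contMDiff.contMDiffOn fun _ ha => ha.2

end FibreProduct

/-! ### Pullbacks of manifolds along submersions -/

namespace Diff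

theorem hom_ext {M N : Diff.{u}} {f g : M ⟶ N} (h : ∀ x, toMap f x = toMap g x) : f = g :=
  ContMDiffMap.ext h

theorem toMap_congr {M N : Diff.{u}} {f g : M ⟶ N} (h : f = g) (x : M.carrier) :
    toMap f x = toMap g x := by
  rw [h]

/-- The constant morphism. -/
noncomputable def const (M : Diff.{u}) {N : Diff.{u}} (y : N.carrier) : M ⟶ N :=
  (ContMDiffMap.const y : C^∞⟮𝓡 M.dim, M.carrier; 𝓡 N.dim, N.carrier⟯)

section FibreProduct

variable {X Y Z : Diff.{u}} (f : X ⟶ Z) (g : Y ⟶ Z) (hg : surjSub g)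

/-- Slice charts of the fibre product. -/
noncomputable def fibreProductSliceChart
    (w : {q : X.carrier × Y.carrier // toMap f q.1 = toMap g q.2}) :
    SliceChart ((𝓡 X.dim).prod (𝓡 Y.dim)) (X.dim + (Y.dim - Z.dim))
      (Subtype.val : {q : X.carrier × Y.carrier // toMap f q.1 = toMap g q.2} → _) w :=
  Classical.choice (nonempty_sliceChart (toMap f).contMDiff (toMap g).contMDiff hg.2 w)

/-- The fibre product of a smooth map and a surjective submersion. -/
noncomputable def fibreProduct : Diff.{u} :=
  let := SliceChart.chartedSpace (fibreProductSliceChart f g hg)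
  { dim := X.dim + (Y.dim - Z.dim)
    carrier := {q : X.carrier × Y.carrier // toMap f q.1 = toMap g q.2}
    smooth := SliceChart.isManifold (fibreProductSliceChart f g hg)
    secondCountable := Topology.IsInducing.subtypeVal.secondCountableTopology
    nonempty := by
      obtain ⟨x⟩ := X.nonempty
      obtain ⟨y, hy⟩ := hg.1 (toMap f x)
      exact ⟨⟨(x, y), hy.symm⟩⟩ }

/-- The first projection of the fibre product. -/
noncomputable def fibreProductFst : fibreProduct f g hg ⟶ X :=
  (⟨fun q => q.1.1, contMDiff_fst.comp (SliceChart.contMDiff (fibreProductSliceChart f g hg))⟩ :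
    C^∞⟮𝓡 (fibreProduct f g hg).dim, (fibreProduct f g hg).carrier; 𝓡 X.dim, X.carrier⟯)

/-- The second projection of the fibre product. -/
noncomputable def fibreProductSnd : fibreProduct f g hg ⟶ Y :=
  (⟨fun q => q.1.2, contMDiff_snd.comp (SliceChart.contMDiff (fibreProductSliceChart f g hg))⟩ :
    C^∞⟮𝓡 (fibreProduct f g hg).dim, (fibreProduct f g hg).carrier; 𝓡 Y.dim, Y.carrier⟯)

theorem contMDiffAt_fibreProduct {N : Diff.{u}} {h : N.carrier → (fibreProduct f g hg).carrier}
    {x : N.carrier}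
    (hh : ContMDiffAt (𝓡 N.dim) ((𝓡 X.dim).prod (𝓡 Y.dim)) ∞ (fun y => (h y).1) x) :
    ContMDiffAt (𝓡 N.dim) (𝓡 (fibreProduct f g hg).dim) ∞ h x :=
  SliceChart.contMDiffAt_of_comp (fibreProductSliceChart f g hg) Topology.IsInducing.subtypeVal hh

theorem isPullback_fibreProduct :
    IsPullback (fibreProductFst f g hg) (fibreProductSnd f g hg) f g where
  w := hom_ext fun q => q.2
  isLimit' := ⟨PullbackCone.IsLimit.mk _
    (fun s =>
      (⟨fun x => ⟨(toMap s.fst x, toMap s.snd x), toMap_congr s.condition x⟩,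
        fun _ => contMDiffAt_fibreProduct f g hg
          ((toMap s.fst).contMDiff.contMDiffAt.prodMk (toMap s.snd).contMDiff.contMDiffAt)⟩ :
        C^∞⟮𝓡 s.pt.dim, s.pt.carrier; 𝓡 (fibreProduct f g hg).dim, (fibreProduct f g hg).carrier⟯))
    (fun _ => rfl) (fun _ => rfl)
    (fun _ _ h₁ h₂ => hom_ext fun x =>
      Subtype.ext (Prod.ext (toMap_congr h₁ x) (toMap_congr h₂ x)))⟩

end FibreProduct

variable {P X Y Z : Diff.{u}} {p : P ⟶ X} {q : P ⟶ Y} {f : X ⟶ Z} {g : Y ⟶ Z}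

/-- The projections of a pullback separate points. -/
theorem eq_of_isPullback (h : IsPullback p q f g) {a b : P.carrier} (hp : toMap p a = toMap p b)
    (hq : toMap q a = toMap q b) : a = b :=
  -- Points are tested by the constant maps from `P` to itself.
  toMap_congr (h.hom_ext (h₀ := (hom_ext fun _ => hp : const P a ≫ p = const P b ≫ p))
    (h₁ := (hom_ext fun _ => hq : const P a ≫ q = const P b ≫ q))) a

open Topology in
/-- Locally defined maps to the feet of a pullback that agree over the base lift to the apex. -/
theorem exists_lift_of_isPullback (h : IsPullback p q f g) (hg : surjSub g) {N : Diff.{u}}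
    {a : N.carrier → X.carrier} {b : N.carrier → Y.carrier} {x : N.carrier}
    (ha : ContMDiffAt (𝓡 N.dim) (𝓡 X.dim) ∞ a x) (hb : ContMDiffAt (𝓡 N.dim) (𝓡 Y.dim) ∞ b x)
    (hab : ∀ᶠ y in 𝓝 x, toMap f (a y) = toMap g (b y)) :
    ∃ l : N.carrier → P.carrier, ContMDiffAt (𝓡 N.dim) (𝓡 P.dim) ∞ l x ∧
      ∀ y, toMap f (a y) = toMap g (b y) → toMap p (l y) = a y ∧ toMap q (l y) = b y := by
  classical
  -- The universal property of `P` applies only to globally defined smooth maps. The lift is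
  -- therefore made pointwise into the explicit fibre product, with an arbitrary value where `a` and
  -- `b` disagree over `Z`, and then carried to `P` by the global morphism `φ`.
  let l₀ : N.carrier → (fibreProduct f g hg).carrier := fun y =>
    if hy : toMap f (a y) = toMap g (b y) then ⟨(a y, b y), hy⟩
    else Classical.choice (fibreProduct f g hg).nonempty
  have hl₀ : ∀ y, toMap f (a y) = toMap g (b y) → (l₀ y).1 = (a y, b y) := fun y hy => by
    exact congrArg Subtype.val (dif_pos hy)
  have hsmooth : ContMDiffAt (𝓡 N.dim) (𝓡 (fibreProduct f g hg).dim) ∞ l₀ x := by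
    refine contMDiffAt_fibreProduct f g hg ((ha.prodMk hb).congr_of_eventuallyEq ?_)
    filter_upwards [hab] with y hy using hl₀ y hy
  let φ := h.lift _ _ (isPullback_fibreProduct f g hg).w
  refine ⟨toMap φ ∘ l₀, (toMap φ).contMDiff.contMDiffAt.comp x hsmooth, fun y hy => ⟨?_, ?_⟩⟩
  · exact (toMap_congr (h.lift_fst _ _ _) (l₀ y)).trans (congrArg Prod.fst (hl₀ y hy))
  · exact (toMap_congr (h.lift_snd _ _ _) (l₀ y)).trans (congrArg Prod.snd (hl₀ y hy))

end Diff

/-! ### Surjective submersions through local sections -/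

open Topology in
-- Replaces derivatives by a lifting problem, which the universal property of a pullback can solve
-- even when no charts of its apex are known.
theorem surjSub_of_sections {M N : Diff.{u}} {φ : M ⟶ N}
    (hφ : Function.Surjective (Diff.toMap φ))
    (h : ∀ x : M.carrier, ∃ s : N.carrier → M.carrier,
      ContMDiffAt (𝓡 N.dim) (𝓡 M.dim) ∞ s (Diff.toMap φ x) ∧ s (Diff.toMap φ x) = x ∧
        ∀ᶠ y in 𝓝 (Diff.toMap φ x), Diff.toMap φ (s y) = y) : surjSub φ := by
  refine ⟨hφ, fun x => ?_⟩
  obtain ⟨s, hs, hsx, hφs⟩ := h x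
  exact surjective_mfderiv_of_section ((Diff.toMap φ).contMDiff.mdifferentiable (by simp) x)
    (hs.mdifferentiableAt (by simp)) hsx hφs

open Topology in
theorem surjSub.exists_section {M N : Diff.{u}} {φ : M ⟶ N} (h : surjSub φ) (x : M.carrier) :
    ∃ s : N.carrier → M.carrier,
      ContMDiffAt (𝓡 N.dim) (𝓡 M.dim) ∞ s (Diff.toMap φ x) ∧ s (Diff.toMap φ x) = x ∧
        ∀ᶠ y in 𝓝 (Diff.toMap φ x), Diff.toMap φ (s y) = y :=
  exists_local_section (Diff.toMap φ).contMDiff x (h.2 x)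

theorem surjSub.dim_le {M N : Diff.{u}} {φ : M ⟶ N} (h : surjSub φ) : N.dim ≤ M.dim :=
  dim_le_of_surjective_mfderiv (h.2 (Classical.choice M.nonempty))

theorem surjSub_iso_hom {M N : Diff.{u}} (e : M ≅ N) : surjSub e.hom := by
  have h : ∀ y, Diff.toMap e.hom (Diff.toMap e.inv y) = y := Diff.toMap_congr e.inv_hom_id
  exact surjSub_of_sections (fun y => ⟨_, h y⟩) fun x => ⟨Diff.toMap e.inv,
    (Diff.toMap e.inv).contMDiff.contMDiffAt, Diff.toMap_congr e.hom_inv_id x, .of_forall h⟩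

/-- Surjective submersions are stable under base change along surjective submersions. -/
theorem surjSub_fst {P X Y Z : Diff.{u}} {p : P ⟶ X} {q : P ⟶ Y} {f : X ⟶ Z} {g : Y ⟶ Z}
    (h : IsPullback p q f g) (hg : surjSub g) : surjSub p := by
  refine surjSub_of_sections (fun x => ?_) fun w => ?_
  · obtain ⟨y, hy⟩ := hg.1 (Diff.toMap f x)
    -- Constant maps turn the compatible pair `(x, y)` into a point of `P`.
    obtain ⟨l, -, hl⟩ := Diff.exists_lift_of_isPullback (N := X) (x := x) h hg
      (contMDiffAt_const (c := x)) (contMDiffAt_const (c := y)) (.of_forall fun _ => hy.symm)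
    exact ⟨l x, (hl x hy.symm).1⟩
  · have hw : Diff.toMap f (Diff.toMap p w) = Diff.toMap g (Diff.toMap q w) :=
      Diff.toMap_congr h.w w
    -- For a local section `s` of `g` through `q w`, the pair of the identity and `s ∘ f` lifts to a
    -- local section of `p` through `w`.
    obtain ⟨s, hs, hs₀, hgs⟩ := hg.exists_section (Diff.toMap q w)
    rw [← hw] at hs hs₀ hgs
    have hgs' := (Diff.toMap f).contMDiff.continuous.continuousAt.eventually hgs
    obtain ⟨l, hl, hl'⟩ := Diff.exists_lift_of_isPullback (N := X) (x := Diff.toMap p w) h hg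
      contMDiffAt_id (hs.comp _ (Diff.toMap f).contMDiff.contMDiffAt)
      (hgs'.mono fun _ hy => hy.symm)
    refine ⟨l, hl, ?_, hgs'.mono fun y hy => (hl' y hy.symm).1⟩
    obtain ⟨h₁, h₂⟩ := hl' _ hgs'.self_of_nhds.symm
    exact Diff.eq_of_isPullback h h₁ (h₂.trans hs₀)

/-- The morphism between pullbacks induced by surjective submersions of the feet is a surjective
submersion. -/
theorem surjSub_of_isPullback {P Q CL CR CA QL QR : Diff.{u}} {cL : CL ⟶ CA} {cR : CR ⟶ CA}
    {pL : P ⟶ CL} {pR : P ⟶ CR} {f : QL ⟶ CL} {g : QR ⟶ CR} {qL : Q ⟶ QL} {qR : Q ⟶ QR}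
    (hcR : surjSub cR) (hf : surjSub f) (hg : surjSub g) (hP : IsPullback pL pR cL cR)
    (hQ : IsPullback qL qR (f ≫ cL) (g ≫ cR)) {Φ : Q ⟶ P} (hL : Φ ≫ pL = qL ≫ f)
    (hR : Φ ≫ pR = qR ≫ g) : surjSub Φ := by
  have hΦL : ∀ z, Diff.toMap pL (Diff.toMap Φ z) = Diff.toMap f (Diff.toMap qL z) :=
    Diff.toMap_congr hL
  have hΦR : ∀ z, Diff.toMap pR (Diff.toMap Φ z) = Diff.toMap g (Diff.toMap qR z) :=
    Diff.toMap_congr hR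
  have hPw : ∀ y, Diff.toMap cL (Diff.toMap pL y) = Diff.toMap cR (Diff.toMap pR y) :=
    Diff.toMap_congr hP.w
  refine surjSub_of_sections (fun y => ?_) fun z => ?_
  · obtain ⟨a, ha⟩ := hf.1 (Diff.toMap pL y)
    obtain ⟨b, hb⟩ := hg.1 (Diff.toMap pR y)
    have hab : Diff.toMap cL (Diff.toMap f a) = Diff.toMap cR (Diff.toMap g b) :=
      (congrArg _ ha).trans ((hPw y).trans (congrArg _ hb.symm))
    obtain ⟨l, -, hl⟩ := Diff.exists_lift_of_isPullback (N := P) (x := y)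
        hQ (surjSub.comp_mem _ _ hg hcR)
      (contMDiffAt_const (c := a)) (contMDiffAt_const (c := b)) (.of_forall fun _ => hab)
    obtain ⟨h₁, h₂⟩ := hl y hab
    refine ⟨l y, Diff.eq_of_isPullback hP ?_ ?_⟩
    · exact (hΦL _).trans ((congrArg _ h₁).trans ha)
    · exact (hΦR _).trans ((congrArg _ h₂).trans hb)
  -- For local sections `s` of `f` and `t` of `g`, the pair `s ∘ pL`, `t ∘ pR` agrees over `CA` near
  -- `Φ z` and lifts to a local section of `Φ` through `z`.
  · obtain ⟨s, hs, hs₀, hfs⟩ := hf.exists_section (Diff.toMap qL z)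
    obtain ⟨t, ht, ht₀, hgt⟩ := hg.exists_section (Diff.toMap qR z)
    rw [← hΦL] at hs hs₀ hfs
    rw [← hΦR] at ht ht₀ hgt
    have hfs' := (Diff.toMap pL).contMDiff.continuous.continuousAt.eventually hfs
    have hgt' := (Diff.toMap pR).contMDiff.continuous.continuousAt.eventually hgt
    have hst : ∀ y, Diff.toMap f (s (Diff.toMap pL y)) = Diff.toMap pL y →
        Diff.toMap g (t (Diff.toMap pR y)) = Diff.toMap pR y →
        Diff.toMap cL (Diff.toMap f (s (Diff.toMap pL y))) =
          Diff.toMap cR (Diff.toMap g (t (Diff.toMap pR y))) := fun y h₁ h₂ =>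
      (congrArg _ h₁).trans ((hPw y).trans (congrArg _ h₂.symm))
    obtain ⟨l, hl, hl'⟩ := Diff.exists_lift_of_isPullback (N := P) (x := Diff.toMap Φ z)
        hQ (surjSub.comp_mem _ _ hg hcR)
      (hs.comp _ (Diff.toMap pL).contMDiff.contMDiffAt)
      (ht.comp _ (Diff.toMap pR).contMDiff.contMDiffAt)
      ((hfs'.and hgt').mono fun y hy => hst y hy.1 hy.2)
    refine ⟨l, hl, ?_, (hfs'.and hgt').mono fun y hy => ?_⟩
    · obtain ⟨h₁, h₂⟩ := hl' _ (hst _ hfs'.self_of_nhds hgt'.self_of_nhds)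
      exact Diff.eq_of_isPullback hQ (h₁.trans hs₀) (h₂.trans ht₀)
    · obtain ⟨h₁, h₂⟩ := hl' _ (hst y hy.1 hy.2)
      refine Diff.eq_of_isPullback hP ?_ ?_
      · exact (hΦL _).trans ((congrArg _ h₁).trans hy.1)
      · exact (hΦR _).trans ((congrArg _ h₂).trans hy.2)

/-! ### The inclusion functor of surjective submersions -/

theorem hasFPullbacks_surjSubInclusion : HasFPullbacks surjSubInclusion.{u} := by
  intro X Y Z f g
  have h := Diff.isPullback_fibreProduct f.hom g.hom g.property
  exact ⟨⟨_⟩, ⟨_, surjSub_fst h g.property⟩, ⟨_, surjSub_fst h.flip f.property⟩, h⟩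

theorem coneTight_surjSubInclusion : ConeTight.{w, w'} surjSubInclusion.{u} := by
  intro J _ D c c' h h'
  let e := h.conePointUniqueUpToIso h'
  exact ⟨Cone.ext (WideSubcategory.isoMk e (surjSub_iso_hom e) (surjSub_iso_hom e.symm)) fun j =>
    WideSubcategory.hom_ext _ (h.conePointUniqueUpToIso_hom_comp h' j).symm, rfl⟩

theorem spanExtendable_surjSubInclusion : SpanExtendable surjSubInclusion.{u} := by
  intro P Q CL CR CA QL QR cL cR pL pR f g qL qR hP hQ Φ hL hR
  have hΦ : surjSub Φ := surjSub_of_isPullback cR.property f.property g.property hP hQ hL hR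
  exact ⟨⟨Φ, hΦ⟩, rfl, WideSubcategory.hom_ext _ hL, WideSubcategory.hom_ext _ hR⟩

/-! ### Terminal objects -/

/-- The one-point manifold. -/
noncomputable def point : Diff.{u} where
  dim := 0
  carrier := PUnit
  charted := ChartedSpace.ofDiscreteTopology
  smooth := by
    let := ChartedSpace.ofDiscreteTopology (M := PUnit.{u + 1}) (H := EuclideanSpace ℝ (Fin 0))
    exact IsManifold.of_discreteTopology (𝕜 := ℝ) (E := EuclideanSpace ℝ (Fin 0)) ∞

/-- The dimension is a separate field of `Diff`, so that it vanishes for a one-point manifold is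
assumed here; it makes every tangent space trivial. -/
theorem surjSub_of_subsingleton {M X : Diff.{u}} [Subsingleton X.carrier] (hX : X.dim = 0)
    (φ : M ⟶ X) : surjSub φ := by
  have hsub : Subsingleton (EuclideanSpace ℝ (Fin X.dim)) := by
    rw [hX]
    infer_instance
  refine ⟨fun y => ?_, fun x v => ⟨0, hsub.elim _ v⟩⟩
  obtain ⟨x⟩ := M.nonempty
  exact ⟨x, Subsingleton.elim _ _⟩

theorem isTerminalObj_diff (X : Diff.{u}) [Subsingleton X.carrier] : IsTerminalObj X := by
  obtain ⟨x⟩ := X.nonempty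
  exact ⟨IsTerminal.ofUniqueHom (fun M => Diff.const M x) fun _ _ =>
    Diff.hom_ext fun _ => Subsingleton.elim _ _⟩

theorem isTerminalObj_surjSub (X : SurjSub.{u}) [Subsingleton X.obj.carrier]
    (hX : X.obj.dim = 0) : IsTerminalObj X := by
  obtain ⟨x⟩ := X.obj.nonempty
  exact ⟨IsTerminal.ofUniqueHom (fun M => ⟨Diff.const M.obj x, surjSub_of_subsingleton hX _⟩)
    fun _ _ => WideSubcategory.hom_ext _ (Diff.hom_ext fun _ => Subsingleton.elim _ _)⟩

instance : Subsingleton point.{u}.carrier := inferInstanceAs (Subsingleton PUnit.{u + 1})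

theorem isTerminalObj_point : IsTerminalObj (⟨point⟩ : SurjSub.{u}) :=
  isTerminalObj_surjSub _ rfl

/-- The target of a surjective submersion from a terminal object is a point. -/
theorem subsingleton_and_dim_eq_zero {P X : SurjSub.{u}} (hP : IsTerminalObj P) (φ : P ⟶ X) :
    Subsingleton X.obj.carrier ∧ X.obj.dim = 0 := by
  obtain ⟨hP⟩ := hP
  obtain ⟨h⟩ := isTerminalObj_point.{u}
  -- Replacing `P` by the isomorphic one-point manifold gives a source of known dimension 0, which
  -- bounds the dimension of `X`.
  let ψ : (⟨point⟩ : SurjSub.{u}) ⟶ X := (h.uniqueUpToIso hP).hom ≫ φ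
  refine ⟨ψ.property.1.subsingleton, Nat.le_zero.1 (surjSub.dim_le ψ.property)⟩

theorem isTerminalObj_of_hom {P X : SurjSub.{u}} (hP : IsTerminalObj P) (φ : P ⟶ X) :
    IsTerminalObj X := by
  obtain ⟨h, h'⟩ := subsingleton_and_dim_eq_zero hP φ
  exact isTerminalObj_surjSub X h'

theorem hasNondegenerateFPullbacks_surjSubInclusion :
    HasNondegenerateFPullbacks surjSubInclusion.{u} := by
  refine ⟨hasFPullbacks_surjSubInclusion, fun X hX => ?_, fun P X Y Z p q f g _ h hP => ?_⟩
  · have := (subsingleton_and_dim_eq_zero hX (𝟙 X)).1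
    exact isTerminalObj_diff X.obj
  · exact h.elim (fun h => h (isTerminalObj_of_hom hP p)) fun h => h (isTerminalObj_of_hom hP q)

end ACM

theorem mainTheorem4 :
    -- the inclusion functor satisfies the standing conditions under which `Kin` is defined
    (HasTerminal ACM.SurjSub.{u} ∧ HasTerminal ACM.Diff.{u} ∧
      ACM.surjSubInclusion.{u}.Faithful ∧
      ACM.ConeTight.{w, w'} ACM.surjSubInclusion.{u} ∧
      ACM.SpanExtendable ACM.surjSubInclusion.{u} ∧
      ACM.HasNondegenerateFPullbacks ACM.surjSubInclusion.{u}) ∧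
    -- an ACM-system depends only on the natural isomorphism class of its diagram
    (∀ (J : ACM.ActorIndex) (D₁ D₂ : J.Objᵒᵖ ⥤ ACM.SurjSub.{u}) (c₁ : Cone D₁) (c₂ : Cone D₂),
      Nonempty (D₁ ≅ D₂) →
      ACM.IsFLimit ACM.surjSubInclusion.{u} c₁ → ACM.IsFLimit ACM.surjSubInclusion.{u} c₂ →
      Nonempty (ACM.coneDiagram c₁ ≅ ACM.coneDiagram c₂)) ∧
    -- ACM-systems and rigid inclusions, with the composition of the underlying inclusions of
    -- shapes, form a category
    (∃ (K : Category.{0} (ACM.ACMSystem ACM.surjSubInclusion.{u}))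
      (e : ∀ S T : ACM.ACMSystem ACM.surjSubInclusion.{u}, K.Hom S T ≃ ACM.RigidInclusion S T),
      (∀ S, (e S S (K.id S)).incl = ACM.ActorIndex.Inclusion.id S.shape) ∧
      (∀ S T U (f : K.Hom S T) (g : K.Hom T U),
        (e S U (K.comp f g)).incl = (e T U g).incl.comp (e S T f).incl)) := by
  refine ⟨⟨?_, ?_, inferInstance, ACM.coneTight_surjSubInclusion,
    ACM.spanExtendable_surjSubInclusion, ACM.hasNondegenerateFPullbacks_surjSubInclusion⟩,
    fun J D₁ D₂ c₁ c₂ ⟨α⟩ h₁ h₂ => ACM.coneTight_surjSubInclusion.nonempty_coneDiagram_iso α h₁ h₂,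
    ACM.kin _, fun _ _ => Equiv.refl _, fun _ => rfl, fun _ _ _ _ _ => rfl⟩
  · obtain ⟨h⟩ := ACM.isTerminalObj_point.{u}
    exact h.hasTerminal
  · obtain ⟨h⟩ := ACM.isTerminalObj_diff ACM.point.{u}
    exact h.hasTerminal
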